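/- **Setting.** Let $A\in\{0,*\}^{n\times n}$ and $B\in\{0,*\}^{n\times m}$ be structured matrices ($*$ a free entry, $0$ a fixed zero). A realization of a structured matrix is a real matrix of the same size that vanishes at its fixed zeros. $(A,B)$ is *structurally controllable* if there are realizations $\tilde A$ of $A$ and $\tilde B$ of $B$ such that $\dot x=\tilde Ax+\tilde Bu$ is controllable. Let $\mathcal N(B)$ be the set of positions of the $*$ entries of $B$, let $\mathcal K(B)=\{B'\in\{0,*\}^{n\times m}:\mathcal N(B')\subseteq\mathcal N(B)\}$, and let $w_{ij}$ be a real cost for each $(i,j)\in\mathcal N(B)$. Put $\|B'\|_0=|\mathcal N(B')|$ and $\|B'\|_w=\sum_{(i,j)\in\mathcal N(B')}w_{ij}$. Consider the problems, over $B'\in\mathcal K(B)$ with $(A,B')$ structurally controllable, - $\mathcal P_1$: minimize $\|B'\|_0$; - $\mathcal P_2$: minimize $\|B'\|_w$; - $\mathcal P_3$ (for a given $k\in\mathbb N$): minimize $\|B'\|_w$ subject to the additional constraint $\|B'\|_0\le k$. Let $X_L=\{x_1^L,\dots,x_n^L\}$, $X_R=\{x_1^R,\dots,x_n^R\}$, $U=\{u_1,\dots,u_m\}$,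 $E_{XX}=\{(x_j^R,x_i^L):A_{ij}\neq0\}$, $E_{UX}=\{(u_j,x_i^L):B_{ij}\ne0\}$, $E=E_{XX}\cup E_{UX}$ and $w_{u_j,x_i^L}=w_{ij}$. Let $\{X_i\}_{i\in\mathcal I}$ be the vertex sets of the source strongly connected components of the digraph on $\{x_1,\dots,x_n\}$ with edges $\{(x_j,x_i):A_{ij}\ne0\}$, that is, of the strongly connected components that no edge enters from outside. For $i\in\mathcal I$ let $E_i=\{(u,x_j^L)\in E_{UX}: x_j\in X_i\}$ and $w_i^{\min}=\min_{(u,v)\in E_i}w_{uv}$. Consider variables $y=(y_{uv})_{(u,v)\in E}$ and $z=(z_i)_{i\in\mathcal I}$ and the constraints $$\begin{aligned} &\textstyle\sum_{u:(u,v)\in E}y_{uv}=1\ \ \forall v\in X_L,\qquad \sum_{v:(u,v)\in E}y_{uv}\le1\ \ \forall u\in X_R\cup U,\\ &\textstyle z_i\le\sum_{(u,v)\in E_i}y_{uv}\ \ \forall i\in\mathcal I,\qquad y_{uv}\in\{0,1\}\ \ \forall (u,v)\in E,\qquad z_i\in\{0,1\}\ \ \forall i\in\mathcal I. \end{aligned}\tag{C}$$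 Define the integer linear programs - $\mathcal P_1^{\rm ILP}$: minimize $\sum_{(u,v)\in E_{UX}}y_{uv}+|\mathcal I|-\sum_{i\in\mathcal I}z_i$ subject to (C); - $\mathcal P_2^{\rm ILP}$: minimize $\sum_{(u,v)\in E_{UX}}w_{uv}y_{uv}+\sum_{i\in\mathcal I}(1-z_i)w_i^{\min}$ subject to (C); - $\mathcal P_3^{\rm ILP}$: minimize the objective of $\mathcal P_2^{\rm ILP}$ subject to (C) and $\sum_{(u,v)\in E_{UX}}y_{uv}+|\mathcal I|-\sum_{i\in\mathcal I}z_i\le k$. **Theorem.** Assume that $(A,B)$ is structurally controllable and that the costs are finite and non-negative, i.e. $0\le w_{ij}<\infty$ for all $(i,j)\in\mathcal N(B)$. Then $\mathcal P_1$ and $\mathcal P_1^{\rm ILP}$ attain their minima, and these are equal; likewise $\mathcal P_2$ and $\mathcal P_2^{\rm ILP}$ attain their minima, and these are equal. For every $k\in\mathbb N$, $\mathcal P_3$ is feasible if and only if $\mathcal P_3^{\rm ILP}$ is feasible, and in that case both attain their minima, and these are equal. -/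

import Mathlib

namespace InputSelection

open Matrix

/-- A structured matrix: `true` marks a free entry (`*`), `false` marks a fixed zero entry. -/
abbrev StructuredMatrix (p q : ℕ) := Matrix (Fin p) (Fin q) Bool

/-- The set of real realizations of a structured matrix. -/
def realizations {p q : ℕ} (M : StructuredMatrix p q) : Set (Matrix (Fin p) (Fin q) ℝ) :=
  {R | ∀ i j, M i j = false → R i j = 0}

/-- Controllability of `x'(t) = A x(t) + B u(t)`: every initial state can be steered to every
final state in some finite time by a continuous input. -/
def Controllable {n m : ℕ} (A : Matrix (Fin n) (Fin n) ℝ) (B : Matrix (Fin n) (Fin m) ℝ) : Prop :=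
  ∀ x₀ x₁ : Fin n → ℝ, ∃ T : ℝ, 0 < T ∧
    ∃ (u : ℝ → Fin m → ℝ) (x : ℝ → Fin n → ℝ), Continuous u ∧
      (∀ t ∈ Set.Icc 0 T, HasDerivWithinAt x (A *ᵥ x t + B *ᵥ u t) (Set.Icc 0 T) t) ∧
      x 0 = x₀ ∧ x T = x₁

/-- `(A, B)` is structurally controllable if some realization is controllable. -/
def StructurallyControllable {n m : ℕ} (A : StructuredMatrix n n) (B : StructuredMatrix n m) :
    Prop :=
  ∃ A' ∈ realizations A, ∃ B' ∈ realizations B, Controllable A' B'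

/-- The set of free entries of a structured matrix. -/
def freeEntries {p q : ℕ} (M : StructuredMatrix p q) : Finset (Fin p × Fin q) :=
  Finset.univ.filter fun e => M e.1 e.2 = true

/-- The structured matrices whose free entries are among those of `B`. -/
def subPatterns {n m : ℕ} (B : StructuredMatrix n m) : Set (StructuredMatrix n m) :=
  {B' | freeEntries B' ⊆ freeEntries B}

/-- The number of free entries. -/
def sparsity {n m : ℕ} (B : StructuredMatrix n m) : ℤ := ((freeEntries B).card : ℤ)

/-- The total cost of the free entries. -/
def totalCost {n m : ℕ} (w : Fin n → Fin m → ℝ) (B : StructuredMatrix n m) : ℝ :=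
  ∑ e ∈ freeEntries B, w e.1 e.2

/-- Feasible region of the constrained sparsest, and of the constrained minimum cost, input
selection problem. -/
def selectionFeasible {n m : ℕ} (A : StructuredMatrix n n) (B : StructuredMatrix n m) :
    Set (StructuredMatrix n m) :=
  {B' | B' ∈ subPatterns B ∧ StructurallyControllable A B'}

/-- Feasible region of the minimum cost `k`-sparsity input selection problem. -/
def sparseSelectionFeasible {n m : ℕ} (A : StructuredMatrix n n) (B : StructuredMatrix n m)
    (k : ℕ) : Set (StructuredMatrix n m) :=
  {B' | B' ∈ selectionFeasible A B ∧ sparsity B' ≤ k}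

/-! ### Source strongly connected components of the state digraph -/

/-- The state digraph has an edge `x_j → x_i` iff the entry `(i, j)` of `A` is free. -/
def StateEdge {n : ℕ} (A : StructuredMatrix n n) (j i : Fin n) : Prop := A i j = true

/-- The subgraph of the state digraph induced on `S` is strongly connected. -/
def StronglyConnectedOn {n : ℕ} (A : StructuredMatrix n n) (S : Finset (Fin n)) : Prop :=
  S.Nonempty ∧ ∀ i ∈ S, ∀ j ∈ S,
    Relation.ReflTransGen (fun a b => a ∈ S ∧ b ∈ S ∧ StateEdge A a b) i j

/-- `S` is the vertex set of a strongly connected component of the state digraph. -/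
def IsSCC {n : ℕ} (A : StructuredMatrix n n) (S : Finset (Fin n)) : Prop :=
  Maximal (StronglyConnectedOn A) S

/-- A source SCC: no edge enters it from outside. -/
def IsSourceSCC {n : ℕ} (A : StructuredMatrix n n) (S : Finset (Fin n)) : Prop :=
  IsSCC A S ∧ ∀ j i, i ∈ S → StateEdge A j i → j ∈ S

open Classical in
/-- The (vertex sets of the) source SCCs; they serve as the index set of the variables `z`. -/
noncomputable def sourceSCCs {n : ℕ} (A : StructuredMatrix n n) : Finset (Finset (Fin n)) :=
  Finset.univ.filter (IsSourceSCC A)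

/-! ### The bipartite graph

A vertex on the left is `x_i^L`, coded by `i : Fin n`; a vertex on the right is `x_j^R`, coded by
`Sum.inl j`, or the input `u_j`, coded by `Sum.inr j`. An edge is written (right vertex, left
vertex). -/

/-- All edges of the bipartite graph: `(x_j^R, x_i^L)` for a free entry `(i, j)` of `A`, and
`(u_j, x_i^L)` for a free entry `(i, j)` of `B`. -/
def bipEdges {n m : ℕ} (A : StructuredMatrix n n) (B : StructuredMatrix n m) :
    Finset ((Fin n ⊕ Fin m) × Fin n) :=
  Finset.univ.filter fun e => Sum.elim (fun j => A e.2 j) (fun j => B e.2 j) e.1 = true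

/-- The edge starts at an input vertex. -/
def IsInputEdge {n m : ℕ} (e : (Fin n ⊕ Fin m) × Fin n) : Prop := e.1.isRight = true

instance {n m : ℕ} : DecidablePred (IsInputEdge (n := n) (m := m)) :=
  fun e => inferInstanceAs (Decidable (e.1.isRight = true))

/-- The cost of an edge: `w i j` for the input link `(u_j, x_i^L)`. The value `0` on the other
edges is never used. -/
def edgeCost {n m : ℕ} (w : Fin n → Fin m → ℝ) (e : (Fin n ⊕ Fin m) × Fin n) : ℝ :=
  Sum.elim (fun _ => 0) (fun j => w e.2 j) e.1

/-- The minimum cost of the input links entering `S`. When there is such a link, as is the case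
for every source SCC if `(A, B)` is structurally controllable, the infimum is over a nonempty
finite set and so is a minimum. -/
noncomputable def minLinkCost {n m : ℕ} (B : StructuredMatrix n m) (w : Fin n → Fin m → ℝ)
    (S : Finset (Fin n)) : ℝ :=
  sInf {c | ∃ i j, i ∈ S ∧ B i j = true ∧ c = w i j}

/-! ### The integer linear programs -/

/-- The decision variables: a variable `y e` for every edge of the bipartite graph, and a variable
`z S` for every source SCC. -/
structure ILPVars {n m : ℕ} (A : StructuredMatrix n n) (B : StructuredMatrix n m) where
  y : ↥(bipEdges A B) → ℤ
  z : ↥(sourceSCCs A) → ℤ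

section ILP

variable {n m : ℕ} {A : StructuredMatrix n n} {B : StructuredMatrix n m}

/-- The common constraints of the three programs. -/
structure ILPVars.Admissible (v : ILPVars A B) : Prop where
  left_eq_one : ∀ x : Fin n, (∑ e : ↥(bipEdges A B) with e.1.2 = x, v.y e) = 1
  right_le_one : ∀ u : Fin n ⊕ Fin m, (∑ e : ↥(bipEdges A B) with e.1.1 = u, v.y e) ≤ 1
  z_le : ∀ S : ↥(sourceSCCs A),
    v.z S ≤ ∑ e : ↥(bipEdges A B) with IsInputEdge e.1 ∧ e.1.2 ∈ S.1, v.y e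
  y_binary : ∀ e, v.y e = 0 ∨ v.y e = 1
  z_binary : ∀ S, v.z S = 0 ∨ v.z S = 1

/-- `∑_{E_UX} y + |I| - ∑_I z`. -/
noncomputable def ILPVars.linkCount (v : ILPVars A B) : ℤ :=
  (∑ e : ↥(bipEdges A B) with IsInputEdge e.1, v.y e) + ((sourceSCCs A).card : ℤ) - ∑ S, v.z S

/-- `∑_{E_UX} w y + ∑_I (1 - z) w^min`. -/
noncomputable def ILPVars.linkCost (w : Fin n → Fin m → ℝ) (v : ILPVars A B) : ℝ :=
  (∑ e : ↥(bipEdges A B) with IsInputEdge e.1, edgeCost w e.1 * (v.y e : ℝ)) +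
    ∑ S : ↥(sourceSCCs A), (1 - (v.z S : ℝ)) * minLinkCost B w S.1

end ILP

/-- Feasible region of the first and of the second program. -/
def ilpFeasible {n m : ℕ} (A : StructuredMatrix n n) (B : StructuredMatrix n m) :
    Set (ILPVars A B) :=
  {v | v.Admissible}

/-- Feasible region of the third program. -/
def sparseIlpFeasible {n m : ℕ} (A : StructuredMatrix n n) (B : StructuredMatrix n m) (k : ℕ) :
    Set (ILPVars A B) :=
  {v | v.Admissible ∧ v.linkCount ≤ k}

/-- `v` is the optimal value of `min {φ x : x ∈ Λ}` (in particular, the minimum is attained). -/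
def IsOptimalValue {α β : Type*} [Preorder β] (Λ : Set α) (φ : α → β) (v : β) : Prop :=
  IsLeast (φ '' Λ) v

end InputSelection

open InputSelection

/-! The core is Lin's criterion: `(A, B')` is structurally controllable iff every source SCC
receives an input link and the bipartite graph has a matching covering all left vertices. In the
programs `y` is such a matching, and `z S = 1` certifies that the matching already links `S`. Every
`S` with `z S = 0` is charged one further link, the cheapest into `S`.

Thus an admissible point gives a selection: the matched links together with a cheapest link for each
`S` with `z S = 0` (`ILPVars.Admissible.exists_selection`). Conversely, a selection contains a
matching, and a link into each source SCC that the matching misses. These links are distinct, since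
source SCCs are disjoint (`exists_admissible_of_selection`). In both directions neither the count
nor the cost increases, so one comparison settles all three problems.

Necessity in Lin's criterion: an observable that evolves autonomously must vanish
(`Controllable.eq_zero_of_intertwines`). This is applied to the projection onto an unlinked source
SCC and to a left null vector of `[A B]` obtained when Hall's condition fails. Sufficiency: the
matching splits the states into stems rooted at inputs and disjoint cycles. The stems with unit
weights pass the eigenvector test, and `SystemOn.append_cycle` attaches the cycles one at a time,
each with a weight so large that its eigenvalues do not interfere with the old system. -/

namespace InputSelection

open Matrix

/-! ### Controllability of a linear system -/

/-- An observable of a controllable system that evolves autonomously is zero. -/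
theorem Controllable.eq_zero_of_intertwines {n m p : ℕ} {A : Matrix (Fin n) (Fin n) ℝ}
    {B : Matrix (Fin n) (Fin m) ℝ} (h : Controllable A B) {P : Matrix (Fin p) (Fin n) ℝ}
    {M : Matrix (Fin p) (Fin p) ℝ} (hA : P * A = M * P) (hB : P * B = 0) : P = 0 := by
  have key : ∀ x₁ : Fin n → ℝ, P *ᵥ x₁ = 0 := by
    intro x₁
    -- Along a trajectory from `0` to `x₁`, the observable `P x` solves `z' = M z` with `z 0 = 0`,
    -- so it vanishes identically.
    obtain ⟨T, hT, u, x, -, hx, hx0, hxT⟩ := h 0 x₁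
    let F : (Fin p → ℝ) →L[ℝ] (Fin p → ℝ) := M.toLin'.toContinuousLinearMap
    let G : (Fin n → ℝ) →L[ℝ] (Fin p → ℝ) := P.toLin'.toContinuousLinearMap
    have hG : ∀ t ∈ Set.Icc 0 T,
        HasDerivWithinAt (fun t => P *ᵥ x t) (F (P *ᵥ x t)) (Set.Icc 0 T) t := by
      intro t ht
      have h1 := (G.hasFDerivAt (x := x t)).comp_hasDerivWithinAt t (hx t ht)
      have h2 : G (A *ᵥ x t + B *ᵥ u t) = F (P *ᵥ x t) := by
        simp [G, F, mulVec_add, mulVec_mulVec, hA, hB]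
      rw [h2] at h1
      exact h1
    have := ODE_solution_unique (v := fun _ => F) (K := ‖F‖₊) (f := fun t => P *ᵥ x t)
      (g := fun _ => 0) (a := 0) (b := T) (fun _ => F.lipschitz)
      (fun t ht => (hG t ht).continuousWithinAt)
      (fun t ht => ((hG t ⟨ht.1, ht.2.le⟩).mono_of_mem_nhdsWithin
        (Icc_mem_nhdsGE_of_mem ht)))
      continuousOn_const
      (fun t _ => by simpa using hasDerivWithinAt_const t (Set.Ici t) (0 : Fin p → ℝ))
      (by simp [hx0])
    simpa [hxT] using this (Set.right_mem_Icc.2 hT.le)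
  ext i j
  simpa using congrFun (key (Pi.single j 1)) i

/-- Kalman's criterion, in the form: a system without nonzero unobserved functionals is
controllable. -/
theorem controllable_of_kalman {n m : ℕ} {A : Matrix (Fin n) (Fin n) ℝ}
    {B : Matrix (Fin n) (Fin m) ℝ}
    (h : ∀ q : Fin n → ℝ, (∀ k : ℕ, q ᵥ* (A ^ k * B) = 0) → q = 0) : Controllable A B := by
  let E := Fin n → ℝ
  let a : E →L[ℝ] E := A.toLin'.toContinuousLinearMap
  let b : (Fin m → ℝ) →L[ℝ] E := B.toLin'.toContinuousLinearMap
  let U : ℝ → E →L[ℝ] E := fun t => NormedSpace.exp (t • a)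
  have ha : ∀ v, a v = A *ᵥ v := fun v => toLin'_apply A v
  have hb : ∀ v, b v = B *ᵥ v := fun v => toLin'_apply B v
  have hU : ∀ t, HasDerivAt U (a * U t) t := fun t => hasDerivAt_exp_smul_const' a t
  have hU' : ∀ t, HasDerivAt U (U t * a) t := fun t => hasDerivAt_exp_smul_const a t
  have hUc : Continuous U := continuous_iff_continuousAt.2 fun t => (hU t).continuousAt
  have hU0 : U 0 = 1 := by simp [U]
  have hUinv : ∀ t, U t * U (-t) = 1 := by
    intro t
    have hc : Commute (t • a) ((-t) • a) := (Commute.refl a).smul_left t |>.smul_right (-t)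
    simp only [U]
    rw [← NormedSpace.exp_add_of_commute_of_mem_ball (𝕂 := ℝ) hc]
    · have h0 : t • a + (-t) • a = 0 := by rw [← add_smul, add_neg_cancel, zero_smul]
      rw [h0, NormedSpace.exp_zero]
    · rw [NormedSpace.expSeries_radius_eq_top]; exact edist_lt_top _ _
    · rw [NormedSpace.expSeries_radius_eq_top]; exact edist_lt_top _ _
  have hUinv' : ∀ t, U (-t) * U t = 1 := fun t => by simpa using hUinv (-t)
  have hgc : ∀ u : C(ℝ, Fin m → ℝ), Continuous fun s => U (-s) (b (u s)) := fun u =>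
    (hUc.comp continuous_neg).clm_apply (b.continuous.comp u.continuous)
  -- By variation of constants the state at time 1 is `U 1 (x₀ + I u)`, so controllability reduces
  -- to surjectivity of `I`.
  let I : C(ℝ, Fin m → ℝ) →ₗ[ℝ] E :=
    { toFun := fun u => ∫ s in (0 : ℝ)..1, U (-s) (b (u s))
      map_add' := fun u v => by
        rw [← intervalIntegral.integral_add ((hgc u).intervalIntegrable _ _)
          ((hgc v).intervalIntegrable _ _)]
        simp
      map_smul' := fun c u => by
        rw [RingHom.id_apply, ← intervalIntegral.integral_smul]
        simp }
  have hI : Function.Surjective I := by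
    rw [← LinearMap.range_eq_top]
    by_contra hne
    obtain ⟨φ₀, hφ0, hφ⟩ := Submodule.exists_le_ker_of_lt_top _ (lt_top_iff_ne_top.2 hne)
    let φ : E →L[ℝ] ℝ := φ₀.toContinuousLinearMap
    have hφI : ∀ u, φ (I u) = 0 := fun u => hφ ⟨u, rfl⟩
    have hg : ∀ v, Continuous fun s => φ (U (-s) (b v)) := fun v =>
      φ.continuous.comp ((hUc.comp continuous_neg).clm_apply continuous_const)
    -- This input turns the integrand of `φ (I u)` into a sum of squares, so `φ ∘ U (-s) ∘ b`
    -- vanishes on `[0, 1]`. Repeated differentiation in `s` brings in the powers of `a`.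
    let u : C(ℝ, Fin m → ℝ) :=
      ⟨fun s j => φ (U (-s) (b (Pi.single j 1))), continuous_pi fun j => hg _⟩
    have hexp : ∀ s (v : Fin m → ℝ),
        φ (U (-s) (b v)) = ∑ j, v j * φ (U (-s) (b (Pi.single j 1))) := by
      intro s v
      have hv : v = ∑ j, v j • (Pi.single j 1 : Fin m → ℝ) := by
        ext i; simp [Finset.sum_apply, Pi.single_apply]
      conv_lhs => rw [hv]
      simp only [map_sum, map_smul, smul_eq_mul]
    have hint : ∫ s in (0 : ℝ)..1, φ (U (-s) (b (u s))) = 0 := by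
      rw [φ.intervalIntegral_comp_comm ((hgc u).intervalIntegrable _ _)]
      exact hφI u
    have hzero : ∀ s ∈ Set.Icc (0 : ℝ) 1, ∀ j, φ (U (-s) (b (Pi.single j 1))) = 0 := by
      intro s hs j
      by_contra hne
      refine (intervalIntegral.integral_pos (zero_lt_one' ℝ)
        (φ.continuous.comp (hgc u)).continuousOn (fun t _ => ?_) ⟨s, hs, ?_⟩).ne' hint
      · rw [Function.comp_apply, hexp]
        exact Finset.sum_nonneg fun j _ => mul_self_nonneg _
      · rw [Function.comp_apply, hexp]
        exact Finset.sum_pos' (fun j _ => mul_self_nonneg _)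
          ⟨j, Finset.mem_univ _, mul_self_pos.2 hne⟩
    have hpow : ∀ k : ℕ, ∀ s ∈ Set.Ioo (0 : ℝ) 1, ∀ v, φ (U (-s) ((a ^ k) (b v))) = 0 := by
      intro k
      induction k with
      | zero =>
        intro s hs v
        simp only [pow_zero, one_apply_eq_self]
        rw [hexp]
        exact Finset.sum_eq_zero fun j _ => by rw [hzero s ⟨hs.1.le, hs.2.le⟩, mul_zero]
      | succ k ih =>
        intro s hs v
        have hd1 : HasDerivAt (fun s => φ (U (-s) ((a ^ k) (b v))))
            (-φ (U (-s) ((a ^ (k + 1)) (b v)))) s := by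
          have h1 : HasDerivAt (fun s => U (-s)) (-(U (-s) * a)) s := by
            simpa [Function.comp_def] using (hU' (-s)).scomp s (hasDerivAt_neg s)
          have h2 := φ.hasFDerivAt.comp_hasDerivAt s
            (h1.clm_apply (hasDerivAt_const s ((a ^ k) (b v))))
          refine h2.congr_deriv ?_
          simp [pow_succ']
        have hd2 : HasDerivAt (fun s => φ (U (-s) ((a ^ k) (b v)))) 0 s := by
          refine (hasDerivAt_const s (0 : ℝ)).congr_of_eventuallyEq ?_
          filter_upwards [Ioo_mem_nhds hs.1 hs.2] with t ht using ih t ht v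
        simpa using hd1.unique hd2
    -- Any interior time serves here: the differentiated identities are available only on the open
    -- interval.
    let ψ : E →ₗ[ℝ] ℝ := (φ.comp (U (-(1 / 2)))).toLinearMap
    let q : Fin n → ℝ := fun i => ψ (Pi.single i 1)
    have hq : ∀ v : E, ψ v = q ⬝ᵥ v := by
      intro v
      have hv : v = ∑ j, v j • (Pi.single j 1 : Fin n → ℝ) := by
        ext i; simp [Finset.sum_apply, Pi.single_apply]
      conv_lhs => rw [hv]
      simp only [map_sum, map_smul, smul_eq_mul, dotProduct, q, mul_comm]
    have hak : ∀ (k : ℕ) v, (a ^ k) v = A ^ k *ᵥ v := by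
      intro k
      induction k with
      | zero => simp
      | succ k ih => intro v; rw [pow_succ', pow_succ', mul_apply_eq_comp, ih, ha,
          mulVec_mulVec]
    have hq0 : q = 0 := by
      refine h q fun k => ?_
      refine dotProduct_eq_zero _ fun v => ?_
      rw [← dotProduct_mulVec, ← mulVec_mulVec, ← hb, ← hak, ← hq]
      exact hpow k (1 / 2) (by norm_num) v
    refine hφ0 (LinearMap.ext fun v => ?_)
    have h1 : φ ((U (-(1 / 2)) * U (1 / 2)) v) = 0 := by
      change ψ (U (1 / 2) v) = 0
      rw [hq, hq0, zero_dotProduct]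
    rwa [hUinv'] at h1
  intro x₀ x₁
  obtain ⟨u, hu⟩ := hI (U (-1) x₁ - x₀)
  refine ⟨1, one_pos, u, fun t => U t (x₀ + ∫ s in (0 : ℝ)..t, U (-s) (b (u s))), u.continuous,
    fun t _ => HasDerivAt.hasDerivWithinAt ?_, by simp [hU0], ?_⟩
  · have h1 := (hU t).clm_apply (((hgc u).integral_hasStrictDerivAt 0 t).hasDerivAt.const_add x₀)
    refine h1.congr_deriv ?_
    rw [← mul_apply_eq_comp (U t), hUinv, mul_apply_eq_comp, ha,
      one_apply_eq_self, hb]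
  · change U 1 (x₀ + I u) = x₁
    rw [hu, add_sub_cancel, ← mul_apply_eq_comp, hUinv, one_apply_eq_self]

/-! ### The Popov–Belevitch–Hautus test -/

theorem exists_norm_vecMul_le {p q : ℕ} (M : Matrix (Fin p) (Fin q) ℂ) :
    ∃ C : ℝ, 0 ≤ C ∧ ∀ v : Fin p → ℂ, ‖v ᵥ* M‖ ≤ C * ‖v‖ :=
  ⟨_, norm_nonneg _, fun v => M.vecMulLinear.toContinuousLinearMap.le_opNorm v⟩

/-- The eigenvector test on an invariant space of functionals implies observability of every
nonzero functional in it. -/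
theorem eq_zero_of_forall_eigenvector {n m : ℕ} {A : Matrix (Fin n) (Fin n) ℂ}
    {B : Matrix (Fin n) (Fin m) ℂ} {W : Submodule ℂ (Fin n → ℂ)}
    (hW : ∀ q ∈ W, q ᵥ* A ∈ W)
    (h : ∀ q ∈ W, ∀ μ : ℂ, q ᵥ* A = μ • q → q ᵥ* B = 0 → q = 0)
    {q : Fin n → ℂ} (hq : q ∈ W) (hqB : ∀ k : ℕ, q ᵥ* (A ^ k * B) = 0) : q = 0 := by
  -- The unobserved functionals in `W` form an invariant subspace. If it is nonzero it contains an
  -- eigenvector over `ℂ`, whose `k = 0` condition contradicts `h`.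
  let N : Submodule ℂ (Fin n → ℂ) :=
    { carrier := {q | q ∈ W ∧ ∀ k : ℕ, q ᵥ* (A ^ k * B) = 0}
      zero_mem' := ⟨W.zero_mem, fun k => zero_vecMul _⟩
      add_mem' := fun ha hb => ⟨W.add_mem ha.1 hb.1, fun k => by
        rw [add_vecMul, ha.2, hb.2, add_zero]⟩
      smul_mem' := fun c x hx => ⟨W.smul_mem c hx.1, fun k => by
        rw [smul_vecMul, hx.2, smul_zero]⟩ }
  have hN : ∀ x ∈ N, A.vecMulLinear x ∈ N := fun x hx => ⟨hW x hx.1, fun k => by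
    have := hx.2 (k + 1)
    rwa [pow_succ', Matrix.mul_assoc, ← vecMul_vecMul] at this⟩
  by_contra hne
  have : Nontrivial N := ⟨⟨⟨q, hq, hqB⟩, 0, fun h0 => hne (congrArg Subtype.val h0)⟩⟩
  obtain ⟨μ, hμ⟩ := Module.End.exists_eigenvalue (A.vecMulLinear.restrict hN)
  obtain ⟨v, hv⟩ := hμ.exists_hasEigenvector
  refine hv.2 (Subtype.ext (h v v.2.1 μ ?_ ?_))
  · exact congrArg Subtype.val hv.apply_eq_smul
  · simpa using v.2.2 0

theorem exists_bound_eigenvalue {n : ℕ} (A : Matrix (Fin n) (Fin n) ℂ) :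
    ∃ R : ℝ, ∀ μ : ℂ, R ≤ ‖μ‖ → ∀ q : Fin n → ℂ, q ᵥ* A = μ • q → q = 0 := by
  obtain ⟨C, -, hC⟩ := exists_norm_vecMul_le A
  refine ⟨C + 1, fun μ hμ q hq => ?_⟩
  have h1 := hC q
  rw [hq, norm_smul] at h1
  have h2 := mul_le_mul_of_nonneg_right hμ (norm_nonneg q)
  exact norm_le_zero_iff.1 (by linarith)

/-- The transfer function from the inputs to an observable functional does not vanish at large
frequencies. -/
theorem exists_bound_transfer {n m : ℕ} (A : Matrix (Fin n) (Fin n) ℂ)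
    (B : Matrix (Fin n) (Fin m) ℂ) {e : Fin n → ℂ} (he : ∃ k : ℕ, e ᵥ* (A ^ k * B) ≠ 0) :
    ∃ R : ℝ, ∀ μ : ℂ, R ≤ ‖μ‖ → ∀ q : Fin n → ℂ, q ᵥ* A + e = μ • q → q ᵥ* B ≠ 0 := by
  classical
  obtain ⟨k, hk, hmin⟩ : ∃ k : ℕ, e ᵥ* (A ^ k * B) ≠ 0 ∧ ∀ i < k, e ᵥ* (A ^ i * B) = 0 :=
    ⟨Nat.find he, Nat.find_spec he, fun i hi => not_not.1 (Nat.find_min he hi)⟩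
  obtain ⟨C, hC0, hC⟩ := exists_norm_vecMul_le A
  obtain ⟨D, hD0, hD⟩ := exists_norm_vecMul_le (A ^ (k + 1) * B)
  have hpos : 0 < ‖e ᵥ* (A ^ k * B)‖ := norm_pos_iff.2 hk
  set δ := ‖e ᵥ* (A ^ k * B)‖ with hδ
  -- If `q ᵥ* B = 0`, the recursion gives `q ᵥ* (A ^ (k + 1) * B) = -e ᵥ* (A ^ k * B)`, hence `δ ≤ D
  -- * ‖q‖`. The equation for `q` gives `‖μ‖ * ‖q‖ ≤ C * ‖q‖ + ‖e‖`. Together they force `‖μ‖ ≤ C +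
  -- D * ‖e‖ / δ`.
  refine ⟨C + 1 + D * ‖e‖ / δ, fun μ hμ q hq hqB => ?_⟩
  have hstep : ∀ i : ℕ, q ᵥ* (A ^ (i + 1) * B) = μ • (q ᵥ* (A ^ i * B)) - e ᵥ* (A ^ i * B) := by
    intro i
    rw [pow_succ', Matrix.mul_assoc, ← vecMul_vecMul, eq_sub_of_add_eq hq, sub_vecMul, smul_vecMul]
  have hz : ∀ i ≤ k, q ᵥ* (A ^ i * B) = 0 := by
    intro i
    induction i with
    | zero => intro _; simpa using hqB
    | succ i ih => intro hi; rw [hstep, ih (by omega), hmin i (by omega), smul_zero, sub_zero]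
  have h1 : δ ≤ D * ‖q‖ := by
    have := hD q
    rwa [hstep, hz k le_rfl, smul_zero, zero_sub, norm_neg] at this
  have h2 : ‖μ‖ * ‖q‖ ≤ C * ‖q‖ + ‖e‖ := by
    rw [← norm_smul, ← hq]
    exact (norm_add_le _ _).trans (by linarith [hC q])
  have h3 := mul_le_mul_of_nonneg_right hμ (norm_nonneg q)
  have hq0 : 0 < ‖q‖ := by
    rcases (norm_nonneg q).eq_or_lt with h0 | h0
    · rw [← h0] at h1; linarith
    · exact h0
  have h4 : D * ‖e‖ / δ * ‖q‖ = ‖e‖ / δ * (D * ‖q‖) := by ring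
  have h5 : ‖e‖ ≤ ‖e‖ / δ * (D * ‖q‖) := by
    calc ‖e‖ = ‖e‖ / δ * δ := by field_simp
      _ ≤ _ := mul_le_mul_of_nonneg_left h1 (by positivity)
  nlinarith

/-! ### Controllable subsystems and their extension by a cycle -/

/-- The matrices describe a system on the states in `S`. -/
structure SystemOn {n m : ℕ} (S : Finset (Fin n)) (A : Matrix (Fin n) (Fin n) ℝ)
    (B : Matrix (Fin n) (Fin m) ℝ) : Prop where
  row_mem : ∀ i j, A i j ≠ 0 → i ∈ S
  col_mem : ∀ i j, A i j ≠ 0 → j ∈ S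
  input_mem : ∀ i j, B i j ≠ 0 → i ∈ S
  hautus : ∀ (q : Fin n → ℂ) (μ : ℂ), (∀ i ∉ S, q i = 0) →
    (∀ j, ∑ i, q i * (A i j : ℂ) = μ * q j) → (∀ u, ∑ i, q i * (B i u : ℂ) = 0) → q = 0

/-- Columns of `A` outside `S` vanish, so the functionals supported on `S` form an invariant space,
to which the eigenvector criterion applies. -/
theorem SystemOn.eq_zero_of_unobserved {n m : ℕ} {S : Finset (Fin n)}
    {A : Matrix (Fin n) (Fin n) ℝ} {B : Matrix (Fin n) (Fin m) ℝ} (h : SystemOn S A B)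
    {q : Fin n → ℂ} (hq : ∀ i ∉ S, q i = 0)
    (hqB : ∀ k : ℕ, q ᵥ* (A.map Complex.ofReal ^ k * B.map Complex.ofReal) = 0) : q = 0 := by
  let W : Submodule ℂ (Fin n → ℂ) :=
    { carrier := {q | ∀ i ∉ S, q i = 0}
      zero_mem' := fun _ _ => rfl
      add_mem' := fun ha hb i hi => by rw [Pi.add_apply, ha i hi, hb i hi, add_zero]
      smul_mem' := fun c _ hx i hi => by rw [Pi.smul_apply, hx i hi, smul_zero] }
  have hWmem : ∀ q : Fin n → ℂ, q ∈ W ↔ ∀ i ∉ S, q i = 0 := fun _ => Iff.rfl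
  refine eq_zero_of_forall_eigenvector (W := W) (fun q hq => ?_) (fun q hq μ h1 h2 => ?_)
    ((hWmem q).2 hq) hqB
  · rw [hWmem] at hq ⊢
    intro j hj
    change ∑ i, q i * (A i j : ℂ) = 0
    refine Finset.sum_eq_zero fun i _ => ?_
    have : A i j = 0 := not_not.1 fun h0 => hj (h.col_mem i j h0)
    simp [this]
  · exact h.hautus q μ ((hWmem q).1 hq) (fun j => congrFun h1 j) (fun u => congrFun h2 u)

theorem SystemOn.controllable {n m : ℕ} {A : Matrix (Fin n) (Fin n) ℝ}
    {B : Matrix (Fin n) (Fin m) ℝ} (h : SystemOn Finset.univ A B) : Controllable A B := by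
  refine controllable_of_kalman fun q hq => ?_
  have h0 := h.eq_zero_of_unobserved (q := fun i => (q i : ℂ)) (by simp) fun k => by
    have h1 : A.map Complex.ofReal ^ k * B.map Complex.ofReal
        = (A ^ k * B).map Complex.ofRealHom := by
      rw [Matrix.map_mul, Matrix.map_pow]; rfl
    ext u
    rw [h1]
    have h2 := RingHom.map_vecMul Complex.ofRealHom (A ^ k * B) q u
    rw [hq k, Pi.zero_apply, map_zero] at h2
    exact h2.symm
  ext i
  simpa using congrFun h0 i

/-- For an eigenvalue of large modulus, no left eigenvector of an extended system excites the
old part through a single link. -/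
theorem SystemOn.exists_bound {n m : ℕ} {S : Finset (Fin n)}
    {A : Matrix (Fin n) (Fin n) ℝ} {B : Matrix (Fin n) (Fin m) ℝ} (h : SystemOn S A B)
    (s : Fin n ⊕ Fin m) (hs : ∀ j, s = Sum.inl j → j ∈ S) :
    ∃ R : ℝ, ∀ μ : ℂ, R ≤ ‖μ‖ → ∀ (q : Fin n → ℂ),
      (∀ j, ∑ i, q i * (A i j : ℂ) + (if s = Sum.inl j then 1 else 0) = μ * q j) →
      (∀ u, ∑ i, q i * (B i u : ℂ) + (if s = Sum.inr u then 1 else 0) = 0) → False := by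
  cases s with
  | inl j =>
    obtain ⟨R, hR⟩ := exists_bound_transfer (A.map Complex.ofReal) (B.map Complex.ofReal)
      (e := Pi.single j 1) (by
        by_contra! hk
        have h0 := h.eq_zero_of_unobserved (q := Pi.single j 1)
          (fun i hi => Pi.single_eq_of_ne (fun hij : i = j => hi (hij.symm ▸ hs j rfl)) _) hk
        simpa using congrFun h0 j)
    refine ⟨R, fun μ hμ q hq hqB => hR μ hμ q ?_ ?_⟩
    · ext i
      have h1 := hq i
      simp only [Sum.inl.injEq] at h1
      simpa [vecMul, dotProduct, Pi.single_apply, eq_comm] using h1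
    · ext u
      simpa [vecMul, dotProduct] using hqB u
  | inr u =>
    obtain ⟨R, hR⟩ := exists_bound_eigenvalue (A.map Complex.ofReal)
    refine ⟨R, fun μ hμ q hq hqB => ?_⟩
    have h0 := hR μ hμ q (by
      ext i
      simpa [vecMul, dotProduct] using hq i)
    simpa [h0] using hqB u

/-- A system stays controllable when a cycle with a large weight is appended to it through one
link. -/
theorem SystemOn.append_cycle {n m : ℕ} {S C : Finset (Fin n)}
    {A : Matrix (Fin n) (Fin n) ℝ} {B : Matrix (Fin n) (Fin m) ℝ} (h : SystemOn S A B)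
    (hSC : Disjoint S C) {p : Fin n → Fin n} (hp : ∀ i ∈ C, p i ∈ C) (hinj : Set.InjOn p C)
    {r : Fin n} (hr : r ∈ C)
    (hconn : ∀ Q : Fin n → Prop, Q r → (∀ i ∈ C, (Q i ↔ Q (p i))) → ∀ i ∈ C, Q i)
    {s : Fin n ⊕ Fin m} (hs : ∀ j, s = Sum.inl j → j ∈ S) :
    ∃ A' B', SystemOn (S ∪ C) A' B' ∧
      (∀ i j, A' i j ≠ 0 → A i j ≠ 0 ∨ (i ∈ C ∧ p i = j) ∨ (i = r ∧ s = Sum.inl j)) ∧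
      (∀ i u, B' i u ≠ 0 → B i u ≠ 0 ∨ (i = r ∧ s = Sum.inr u)) := by
  obtain ⟨R, hR⟩ := h.exists_bound s hs
  -- An eigenvector that is nonzero at `r` will have `‖μ‖ = c`, and `c ≥ R` then contradicts `hR`.
  -- The `1` only ensures `c > 0`.
  let c : ℝ := max R 1
  have hc : 0 < c := lt_of_lt_of_le one_pos (le_max_right _ _)
  let A' : Matrix (Fin n) (Fin n) ℝ := fun i j =>
    A i j + (if i ∈ C ∧ p i = j then c else 0) + (if i = r ∧ s = Sum.inl j then 1 else 0)
  let B' : Matrix (Fin n) (Fin m) ℝ := fun i u => B i u + (if i = r ∧ s = Sum.inr u then 1 else 0)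
  have hA' : ∀ i j, A' i j ≠ 0 → A i j ≠ 0 ∨ (i ∈ C ∧ p i = j) ∨ (i = r ∧ s = Sum.inl j) := by
    intro i j hij
    by_contra! hcon
    refine hij ?_
    simp only [A', hcon.1, zero_add]
    rw [if_neg (fun h => hcon.2.1 h.1 h.2), if_neg (fun h => hcon.2.2 h.1 h.2), add_zero]
  have hB' : ∀ i u, B' i u ≠ 0 → B i u ≠ 0 ∨ (i = r ∧ s = Sum.inr u) := by
    intro i u hiu
    by_contra! hcon
    refine hiu ?_
    simp only [B', hcon.1, zero_add]
    rw [if_neg (fun h => hcon.2 h.1 h.2)]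
  refine ⟨A', B', ⟨fun i j hij => ?_, fun i j hij => ?_, fun i u hiu => ?_, ?_⟩, hA', hB'⟩
  · rcases hA' i j hij with h1 | h1 | h1
    · exact Finset.mem_union_left _ (h.row_mem i j h1)
    · exact Finset.mem_union_right _ h1.1
    · exact Finset.mem_union_right _ (h1.1 ▸ hr)
  · rcases hA' i j hij with h1 | h1 | h1
    · exact Finset.mem_union_left _ (h.col_mem i j h1)
    · exact Finset.mem_union_right _ (h1.2 ▸ hp i h1.1)
    · exact Finset.mem_union_left _ (hs j h1.2)
  · rcases hB' i u hiu with h1 | h1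
    · exact Finset.mem_union_left _ (h.input_mem i u h1)
    · exact Finset.mem_union_right _ (h1.1 ▸ hr)
  intro q μ hq hqA hqB
  have hsumA : ∀ j, ∑ i, q i * (A' i j : ℂ) = ∑ i, q i * (A i j : ℂ)
      + c * (∑ i ∈ C with p i = j, q i) + q r * (if s = Sum.inl j then 1 else 0) := by
    intro j
    have h1 : ∀ i, q i * (A' i j : ℂ) = q i * (A i j : ℂ)
        + (if i ∈ C ∧ p i = j then (c : ℂ) * q i else 0)
        + (if i = r then q i * (if s = Sum.inl j then 1 else 0) else 0) := by
      intro i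
      simp only [A']
      simp only [ite_and]
      split_ifs <;> push_cast <;> ring
    simp only [h1, Finset.sum_add_distrib, Finset.sum_ite_eq', Finset.mem_univ, if_true]
    congr 2
    rw [Finset.mul_sum, ← Finset.sum_filter]
    refine Finset.sum_congr ?_ fun _ _ => rfl
    ext i; simp
  have hsumB : ∀ u, ∑ i, q i * (B' i u : ℂ) = ∑ i, q i * (B i u : ℂ)
      + q r * (if s = Sum.inr u then 1 else 0) := by
    intro u
    have h1 : ∀ i, q i * (B' i u : ℂ) = q i * (B i u : ℂ)
        + (if i = r then q i * (if s = Sum.inr u then 1 else 0) else 0) := by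
      intro i
      simp only [B']
      simp only [ite_and]
      split_ifs <;> push_cast <;> ring
    simp only [h1, Finset.sum_add_distrib, Finset.sum_ite_eq', Finset.mem_univ, if_true]
  have hCS : ∀ {i}, i ∈ C → i ∉ S := fun hi hi' => Finset.disjoint_left.1 hSC hi' hi
  -- Column `p i` has a single nonzero entry, the cycle edge from row `i`: the old system and the
  -- new link have their columns in `S`.
  have hcyc : ∀ i ∈ C, (c : ℂ) * q i = μ * q (p i) := by
    intro i hi
    have h1 := hqA (p i)
    have h2 : ∑ k, q k * (A k (p i) : ℂ) = 0 := Finset.sum_eq_zero fun k _ => by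
      have : A k (p i) = 0 := not_not.1 fun h0 => hCS (hp i hi) (h.col_mem _ _ h0)
      simp [this]
    have h3 : {k ∈ C | p k = p i} = ({i} : Finset (Fin n)) := by
      ext k
      simp only [Finset.mem_filter, Finset.mem_singleton]
      exact ⟨fun hk => hinj hk.1 hi hk.2, fun hk => by rw [hk]; exact ⟨hi, rfl⟩⟩
    rw [hsumA, h2, h3, if_neg (fun h0 => hCS (hp i hi) (hs _ h0))] at h1
    simpa using h1
  -- The old part feels the cycle only through the forcing term `q r` at `s`.
  let q' : Fin n → ℂ := fun i => if i ∈ S then q i else 0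
  have hq'A : ∀ j, ∑ i, q' i * (A i j : ℂ) + q r * (if s = Sum.inl j then 1 else 0)
      = μ * q' j := by
    intro j
    have h1 : ∑ i, q' i * (A i j : ℂ) = ∑ i, q i * (A i j : ℂ) := by
      refine Finset.sum_congr rfl fun i _ => ?_
      by_cases hi : i ∈ S
      · simp [q', hi]
      · have : A i j = 0 := not_not.1 fun h0 => hi (h.row_mem _ _ h0)
        simp [this]
    by_cases hj : j ∈ S
    · have h2 : {k ∈ C | p k = j} = (∅ : Finset (Fin n)) :=
        Finset.filter_eq_empty_iff.2 fun k hk h0 => hCS (hp k hk) (h0 ▸ hj)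
      have h3 := hqA j
      rw [hsumA, h2] at h3
      rw [h1]
      simpa [q', hj] using h3
    · have h2 : ∀ i, A i j = 0 := fun i => not_not.1 fun h0 => hj (h.col_mem _ _ h0)
      have h3 : s ≠ Sum.inl j := fun h0 => hj (hs j h0)
      simp [h2, h3, q', hj]
  have hq'B : ∀ u, ∑ i, q' i * (B i u : ℂ) + q r * (if s = Sum.inr u then 1 else 0) = 0 := by
    intro u
    refine Eq.trans ?_ ((hsumB u).symm.trans (hqB u))
    congr 1
    refine Finset.sum_congr rfl fun i _ => ?_
    by_cases hi : i ∈ S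
    · simp [q', hi]
    · have : B i u = 0 := not_not.1 fun h0 => hi (h.input_mem _ _ h0)
      simp [this]
  have hc0 : (c : ℂ) ≠ 0 := by exact_mod_cast hc.ne'
  -- If `q r = 0`, then `q` vanishes along the cycle and its old part satisfies the old eigenvector
  -- test. Otherwise `q'` divided by `q r` contradicts `hR`.
  by_cases ht : q r = 0
  · have hC0 : ∀ i ∈ C, q i = 0 := by
      by_cases hμ : μ = 0
      · intro i hi
        have := hcyc i hi
        rw [hμ, zero_mul] at this
        exact (mul_eq_zero.1 this).resolve_left hc0
      · refine hconn (fun i => q i = 0) ht fun i hi => ?_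
        have := hcyc i hi
        constructor
        · intro h0
          rw [h0, mul_zero] at this
          exact (mul_eq_zero.1 this.symm).resolve_left hμ
        · intro h0
          rw [h0, mul_zero] at this
          exact (mul_eq_zero.1 this).resolve_left hc0
    have hq0 : q' = 0 := h.hautus q' μ (fun i hi => by simp [q', hi])
      (fun j => by simpa [ht] using hq'A j) (fun u => by simpa [ht] using hq'B u)
    ext i
    by_cases hi : i ∈ S
    · simpa [q', hi] using congrFun hq0 i
    · by_cases hi' : i ∈ C
      · exact hC0 i hi'
      · exact hq i (by simp [hi, hi'])
  · exfalso
    have himg : C.image p = C :=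
      Finset.eq_of_subset_of_card_le (Finset.image_subset_iff.2 hp)
        (Finset.card_image_of_injOn hinj).ge
    have hsum : c * ∑ i ∈ C, ‖q i‖ = ‖μ‖ * ∑ i ∈ C, ‖q i‖ := by
      conv_rhs => rw [← himg]
      rw [Finset.sum_image hinj, Finset.mul_sum, Finset.mul_sum]
      refine Finset.sum_congr rfl fun i hi => ?_
      have := congrArg norm (hcyc i hi)
      rwa [norm_mul, norm_mul, Complex.norm_real, Real.norm_of_nonneg hc.le] at this
    have hpos : 0 < ∑ i ∈ C, ‖q i‖ :=
      Finset.sum_pos' (fun i _ => norm_nonneg _) ⟨r, hr, norm_pos_iff.2 ht⟩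
    have hμ : ‖μ‖ = c := (mul_right_cancel₀ hpos.ne' hsum).symm
    refine hR μ (hμ ▸ le_max_left R 1) (fun i => (q r)⁻¹ * q' i) (fun j => ?_) fun u => ?_
    · have := congrArg ((q r)⁻¹ * ·) (hq'A j)
      simp only [mul_add, inv_mul_cancel_left₀ ht, Finset.mul_sum] at this
      simp only [mul_assoc] at this ⊢
      rw [this]; ring
    · have := congrArg ((q r)⁻¹ * ·) (hq'B u)
      simp only [mul_add, inv_mul_cancel_left₀ ht, Finset.mul_sum, mul_zero] at this
      simp only [mul_assoc] at this ⊢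
      exact this

/-! ### Structural controllability -/

/-- `π` matches every state to a state or an input along an edge of the bipartite graph, and is
injective. -/
def IsMatching {n m : ℕ} (A : StructuredMatrix n n) (B : StructuredMatrix n m)
    (π : Fin n → Fin n ⊕ Fin m) : Prop :=
  Function.Injective π ∧ ∀ i, (π i, i) ∈ bipEdges A B

theorem mem_bipEdges_inl {n m : ℕ} {A : StructuredMatrix n n} {B : StructuredMatrix n m}
    {i j : Fin n} : (Sum.inl j, i) ∈ bipEdges A B ↔ A i j = true := by
  simp [bipEdges]

theorem mem_bipEdges_inr {n m : ℕ} {A : StructuredMatrix n n} {B : StructuredMatrix n m}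
    {i : Fin n} {j : Fin m} : (Sum.inr j, i) ∈ bipEdges A B ↔ B i j = true := by
  simp [bipEdges]

/-- Without a link into `S`, the coordinates in `S` evolve autonomously, since no edge enters `S`
either. -/
theorem StructurallyControllable.exists_link {n m : ℕ} {A : StructuredMatrix n n}
    {B : StructuredMatrix n m} (h : StructurallyControllable A B) {S : Finset (Fin n)}
    (hS : IsSourceSCC A S) : ∃ i ∈ S, ∃ j, B i j = true := by
  classical
  obtain ⟨A', hA', B', hB', hc⟩ := h
  by_contra! hno
  let P : Matrix (Fin n) (Fin n) ℝ := diagonal fun i => if i ∈ S then 1 else 0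
  have hP : P = 0 := hc.eq_zero_of_intertwines (M := P * A') (by
      ext i j
      by_cases hi : i ∈ S
      · by_cases hj : j ∈ S
        · simp [P, diagonal_mul, mul_diagonal, hi, hj]
        · have : A' i j = 0 := hA' i j (Bool.eq_false_iff.2 fun h0 => hj (hS.2 j i hi h0))
          simp [P, diagonal_mul, mul_diagonal, hi, hj, this]
      · simp [P, diagonal_mul, mul_diagonal, hi]) (by
      ext i j
      by_cases hi : i ∈ S
      · simp [P, diagonal_mul, hi, hB' i j (Bool.eq_false_iff.2 (hno i hi j))]
      · simp [P, diagonal_mul, hi])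
  obtain ⟨i, hi⟩ := hS.1.prop.1
  simpa [P, hi] using congrFun (congrFun hP i) i

/-- If Hall's condition fails at `s`, the rows of `[A' B']` in `s` are supported on fewer than
`s.card` columns and so are dependent. The dependency is a nonzero functional that is constant along
every trajectory. -/
theorem StructurallyControllable.exists_isMatching {n m : ℕ} {A : StructuredMatrix n n}
    {B : StructuredMatrix n m} (h : StructurallyControllable A B) : ∃ π, IsMatching A B π := by
  classical
  obtain ⟨A', hA', B', hB', hc⟩ := h
  suffices hall : ∀ s : Finset (Fin n), s.card ≤
      (s.biUnion fun i => Finset.univ.filter fun u => (u, i) ∈ bipEdges A B).card by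
    obtain ⟨π, h1, h2⟩ := (Finset.all_card_le_biUnion_card_iff_exists_injective _).1 hall
    exact ⟨π, h1, fun i => by simpa using h2 i⟩
  intro s
  by_contra! hlt
  set N := s.biUnion fun i => Finset.univ.filter fun u => (u, i) ∈ bipEdges A B with hN
  let M : Fin n → Fin n ⊕ Fin m → ℝ := fun i => Sum.elim (A' i) (B' i)
  have hM : ∀ i ∈ s, ∀ u, u ∉ N → M i u = 0 := by
    intro i hi u hu
    have h1 : (u, i) ∉ bipEdges A B := fun h0 =>
      hu (Finset.mem_biUnion.2 ⟨i, hi, Finset.mem_filter.2 ⟨Finset.mem_univ _, h0⟩⟩)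
    cases u with
    | inl j => exact hA' i j (Bool.eq_false_iff.2 fun h0 => h1 (mem_bipEdges_inl.2 h0))
    | inr j => exact hB' i j (Bool.eq_false_iff.2 fun h0 => h1 (mem_bipEdges_inr.2 h0))
  let f : (s → ℝ) →ₗ[ℝ] (N → ℝ) := (Matrix.of fun (i : s) (u : N) => M i u).vecMulLinear
  have hker : LinearMap.ker f ≠ ⊥ := LinearMap.ker_ne_bot_of_finrank_lt (by simpa using hlt)
  obtain ⟨q, hq, hq0⟩ := Submodule.exists_mem_ne_zero_of_ne_bot hker
  let q' : Fin n → ℝ := fun i => if hi : i ∈ s then q ⟨i, hi⟩ else 0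
  have hsum : ∀ u, ∑ i, q' i * M i u = 0 := by
    intro u
    have h1 : ∑ i, q' i * M i u = ∑ i : s, q i * M i u := by
      rw [← Finset.sum_subset (Finset.subset_univ s) fun i _ hi => by simp [q', hi],
        ← Finset.sum_coe_sort s]
      exact Finset.sum_congr rfl fun i _ => by simp [q']
    rw [h1]
    by_cases hu : u ∈ N
    · exact congrFun (LinearMap.mem_ker.1 hq) ⟨u, hu⟩
    · exact Finset.sum_eq_zero fun i _ => by rw [hM i i.2 u hu, mul_zero]
  have hP := hc.eq_zero_of_intertwines (P := Matrix.of fun (_ : Fin 1) => q') (M := 0)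
    (by ext i j; simpa [Matrix.mul_apply, M] using hsum (Sum.inl j))
    (by ext i j; simpa [Matrix.mul_apply, M] using hsum (Sum.inr j))
  refine hq0 (funext fun i => ?_)
  have := congrFun (congrFun hP 0) i
  simpa [q'] using this

/-- A nonempty set of states closed under predecessors contains a source SCC. -/
theorem exists_isSourceSCC_subset {n : ℕ} {A : StructuredMatrix n n} {T : Finset (Fin n)}
    (hT : T.Nonempty) (hclosed : ∀ j i, i ∈ T → StateEdge A j i → j ∈ T) :
    ∃ S ⊆ T, IsSourceSCC A S := by
  classical
  -- A minimal nonempty predecessor-closed set is strongly connected: its states that reach a given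
  -- `j` inside it are again predecessor-closed, hence all of it.
  obtain ⟨S, ⟨⟨hST, hne, hS⟩, hmin⟩⟩ := (Set.toFinite {S : Finset (Fin n) |
    S ⊆ T ∧ S.Nonempty ∧ ∀ j i, i ∈ S → StateEdge A j i → j ∈ S}).exists_minimal
    ⟨T, subset_rfl, hT, hclosed⟩
  refine ⟨S, hST, ⟨⟨hne, ?_⟩, ?_⟩, hS⟩
  · intro i hi j hj
    let D := S.filter fun k =>
      Relation.ReflTransGen (fun a b => a ∈ S ∧ b ∈ S ∧ StateEdge A a b) k j
    have hD : S ⊆ D := hmin ⟨(Finset.filter_subset _ _).trans hST,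
      ⟨j, Finset.mem_filter.2 ⟨hj, .refl⟩⟩, fun a b hb hab => by
        obtain ⟨hbS, hbj⟩ := Finset.mem_filter.1 hb
        have haS := hS a b hbS hab
        exact Finset.mem_filter.2 ⟨haS, .head ⟨haS, hbS, hab⟩ hbj⟩⟩ (Finset.filter_subset _ _)
    exact (Finset.mem_filter.1 (hD hi)).2
  · intro S' hS' hle k hk
    obtain ⟨i, hi⟩ := hne
    have hpath := hS'.2 k hk i (hle hi)
    induction hpath using Relation.ReflTransGen.head_induction_on with
    | refl => exact hi
    | head hab _ ih => exact hS _ _ (ih hab.2.1) hab.2.2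

/-- A path ending in `S`, traced backwards, cannot leave `S`. -/
theorem IsSourceSCC.subset_of_mem {n : ℕ} {A : StructuredMatrix n n} {S S' : Finset (Fin n)}
    (hS : IsSourceSCC A S) (hS' : IsSourceSCC A S') {i : Fin n} (hi : i ∈ S) (hi' : i ∈ S') :
    S' ⊆ S := by
  intro k hk
  have hpath := hS'.1.prop.2 k hk i hi'
  induction hpath using Relation.ReflTransGen.head_induction_on with
  | refl => exact hi
  | head hab _ ih => exact hS.2 _ _ (ih hab.2.1) hab.2.2

theorem IsSourceSCC.eq_of_mem {n : ℕ} {A : StructuredMatrix n n} {S S' : Finset (Fin n)}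
    (hS : IsSourceSCC A S) (hS' : IsSourceSCC A S') {i : Fin n} (hi : i ∈ S) (hi' : i ∈ S') :
    S = S' :=
  (hS'.subset_of_mem hS hi' hi).antisymm (hS.subset_of_mem hS' hi hi')

/-- The states on a path of matched edges that starts at an input. -/
inductive OnStem {n m : ℕ} (π : Fin n → Fin n ⊕ Fin m) : Fin n → Prop
  | root (i : Fin n) (u : Fin m) : π i = Sum.inr u → OnStem π i
  | step (i j : Fin n) : π i = Sum.inl j → OnStem π j → OnStem π i

/-- Put weight one on the matched edges of the stems. By injectivity of `π` each column used has one
nonzero entry, so a functional failing the test vanishes at the roots and then inductively along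
each stem. -/
theorem exists_systemOn_stems {n m : ℕ} {A : StructuredMatrix n n} {B : StructuredMatrix n m}
    {π : Fin n → Fin n ⊕ Fin m} (hπ : IsMatching A B π) {S : Finset (Fin n)}
    (hS : ∀ i, i ∈ S ↔ OnStem π i) :
    ∃ A' ∈ realizations A, ∃ B' ∈ realizations B, SystemOn S A' B' := by
  let A' : Matrix (Fin n) (Fin n) ℝ := fun i j => if i ∈ S ∧ π i = Sum.inl j then 1 else 0
  let B' : Matrix (Fin n) (Fin m) ℝ := fun i u => if π i = Sum.inr u then 1 else 0
  have hA : ∀ i j, A' i j ≠ 0 → i ∈ S ∧ π i = Sum.inl j := fun i j h0 => by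
    by_contra hcon; exact h0 (if_neg hcon)
  have hB : ∀ i u, B' i u ≠ 0 → π i = Sum.inr u := fun i j h0 => by
    by_contra hcon; exact h0 (if_neg hcon)
  refine ⟨A', fun i j hij => ?_, B', fun i u hiu => ?_,
    ⟨fun i j h0 => (hA i j h0).1, fun i j h0 => ?_, fun i u h0 => ?_, ?_⟩⟩
  · by_contra h0
    have h1 := hπ.2 i
    rw [(hA i j h0).2, mem_bipEdges_inl, hij] at h1
    exact Bool.false_ne_true h1
  · by_contra h0
    have h1 := hπ.2 i
    rw [hB i u h0, mem_bipEdges_inr, hiu] at h1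
    exact Bool.false_ne_true h1
  · obtain ⟨h1, h2⟩ := hA i j h0
    rw [hS] at h1 ⊢
    cases h1 with
    | root _ u h3 => rw [h2] at h3; cases h3
    | step _ k h3 h4 => rw [h2, Sum.inl.injEq] at h3; exact h3 ▸ h4
  · exact (hS i).2 (.root i u (hB i u h0))
  · intro q μ hq hqA hqB
    have hstem : ∀ i, OnStem π i → q i = 0 := by
      intro i hi
      induction hi with
      | root i u hu =>
        rw [← hqB u, Finset.sum_eq_single i]
        · simp [B', hu]
        · intro k _ hk
          have : B' k u = 0 := if_neg fun h0 => hk (hπ.1 (h0.trans hu.symm))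
          simp [this]
        · simp
      | step i j hj hst ih =>
        have h1 := hqA j
        rw [ih, mul_zero, Finset.sum_eq_single i] at h1
        · have : A' i j = 1 := if_pos ⟨(hS i).2 (.step i j hj hst), hj⟩
          simpa [this] using h1
        · intro k _ hk
          have : A' k j = 0 := if_neg fun h0 => hk (hπ.1 (h0.2.trans hj.symm))
          simp [this]
        · simp
    ext i
    by_cases hi : i ∈ S
    · exact hstem i ((hS i).1 hi)
    · exact hq i hi

/-- Lin's theorem, the sufficient part. -/
theorem structurallyControllable_of_isMatching {n m : ℕ} {A : StructuredMatrix n n}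
    {B : StructuredMatrix n m} (hlink : ∀ S, IsSourceSCC A S → ∃ i ∈ S, ∃ j, B i j = true)
    {π : Fin n → Fin n ⊕ Fin m} (hπ : IsMatching A B π) : StructurallyControllable A B := by
  classical
  let S₀ : Finset (Fin n) := Finset.univ.filter (OnStem π)
  have hS₀ : ∀ i, i ∈ S₀ ↔ OnStem π i := fun i => by simp [S₀]
  -- Take a maximal union of the stems with whole matching cycles that carries a controllable
  -- realization; if it is not everything, one more cycle can be attached.
  obtain ⟨S, ⟨⟨hsub, hcl, A', hA', B', hB', hsys⟩, hmax⟩⟩ :=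
    (Set.toFinite {S : Finset (Fin n) | S₀ ⊆ S ∧ (∀ i j, π i = Sum.inl j → (i ∈ S ↔ j ∈ S)) ∧
      ∃ A' ∈ realizations A, ∃ B' ∈ realizations B, SystemOn S A' B'}).exists_maximal
    ⟨S₀, subset_rfl, fun i j hij => by
      rw [hS₀, hS₀]
      refine ⟨fun h => ?_, .step i j hij⟩
      cases h with
      | root _ u h3 => rw [hij] at h3; cases h3
      | step _ k h3 h4 => rw [hij, Sum.inl.injEq] at h3; exact h3 ▸ h4,
      exists_systemOn_stems hπ hS₀⟩
  rcases eq_or_ne S Finset.univ with rfl | hne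
  · exact ⟨A', hA', B', hB', hsys.controllable⟩
  exfalso
  -- Otherwise the complement of `S` would be predecessor-closed and free of input links, yet
  -- contain a source SCC.
  obtain ⟨r, s, hr, hs, hrs⟩ : ∃ (r : Fin n) (s : Fin n ⊕ Fin m), r ∉ S ∧
      (∀ j, s = Sum.inl j → j ∈ S) ∧ (s, r) ∈ bipEdges A B := by
    by_contra! hcon
    have hT : Sᶜ.Nonempty := by
      rw [Finset.nonempty_iff_ne_empty, Ne, Finset.compl_eq_empty_iff]; exact hne
    obtain ⟨T, hTS, hT⟩ := exists_isSourceSCC_subset (A := A) hT fun j i hi hji => by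
      rw [Finset.mem_compl] at hi ⊢
      exact fun hj => hcon i (Sum.inl j) hi (fun k hk => Sum.inl.inj hk ▸ hj)
        (mem_bipEdges_inl.2 hji)
    obtain ⟨i, hi, j, hij⟩ := hlink T hT
    exact hcon i (Sum.inr j) (Finset.mem_compl.1 (hTS hi)) (fun k hk => by cases hk)
      (mem_bipEdges_inr.2 hij)
  -- The default `i` occurs only at states matched to inputs, which lie in `S`. Off `S`, `p` is the
  -- matching itself.
  let p : Fin n → Fin n := fun i => Sum.elim id (fun _ => i) (π i)
  have hp : ∀ i ∉ S, π i = Sum.inl (p i) ∧ p i ∉ S := by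
    intro i hi
    cases hpi : π i with
    | inl j => simpa [p, hpi] using fun hj => hi ((hcl i j hpi).2 hj)
    | inr u => exact absurd (hsub ((hS₀ i).2 (.root i u hpi))) hi
  -- The cycle of `r` under the injective map `p`, taken as an equivalence class so that it is
  -- closed in both directions.
  let C : Finset (Fin n) := Finset.univ.filter fun i =>
    Relation.EqvGen (fun a b => a ∉ S ∧ p a = b) r i
  have hCmem : ∀ i, i ∈ C ↔ Relation.EqvGen (fun a b => a ∉ S ∧ p a = b) r i := fun i => by
    simp [C]
  have hEqv : ∀ i k, Relation.EqvGen (fun a b => a ∉ S ∧ p a = b) i k → (i ∈ S ↔ k ∈ S) := by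
    intro i k hik
    induction hik with
    | rel a b hab =>
      have := hp a hab.1
      rw [hab.2] at this
      simp [hab.1, this.2]
    | refl a => rfl
    | symm a b _ ih => exact ih.symm
    | trans a b c _ _ ih1 ih2 => exact ih1.trans ih2
  have hCS : ∀ i ∈ C, i ∉ S := fun i hi h0 => hr ((hEqv r i ((hCmem i).1 hi)).2 h0)
  have hrC : r ∈ C := (hCmem r).2 (.refl r)
  have hpC : ∀ i ∈ C, p i ∈ C := fun i hi =>
    (hCmem _).2 (.trans _ _ _ ((hCmem i).1 hi) (.rel _ _ ⟨hCS i hi, rfl⟩))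
  have hinj : Set.InjOn p C := fun i hi k hk hik => by
    refine hπ.1 ?_
    rw [(hp i (hCS i hi)).1, (hp k (hCS k hk)).1, hik]
  have hconn : ∀ Q : Fin n → Prop, Q r → (∀ i ∈ C, (Q i ↔ Q (p i))) → ∀ i ∈ C, Q i := by
    intro Q hQr hQ i hi
    have key : ∀ a b, Relation.EqvGen (fun a b => a ∉ S ∧ p a = b) a b → a ∈ C →
        (Q a ↔ Q b) := by
      intro a b hab
      induction hab with
      | rel a b hab => intro ha; rw [← hab.2]; exact hQ a ha
      | refl a => intro _; rfl
      | symm a b hab ih =>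
        intro hb
        exact (ih ((hCmem _).2 (.trans _ _ _ ((hCmem _).1 hb) (.symm _ _ hab)))).symm
      | trans a b c hab _ ih1 ih2 =>
        intro ha
        exact (ih1 ha).trans (ih2 ((hCmem _).2 (.trans _ _ _ ((hCmem _).1 ha) hab)))
    exact (key r i ((hCmem i).1 hi) hrC).1 hQr
  obtain ⟨A₂, B₂, hsys₂, hA₂, hB₂⟩ := hsys.append_cycle
    (Finset.disjoint_right.2 hCS) hpC hinj hrC hconn hs
  have hle : S ∪ C ⊆ S := by
    refine hmax ⟨hsub.trans Finset.subset_union_left, fun i j hij => ?_, A₂, fun i j hij => ?_,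
      B₂, fun i u hiu => ?_, hsys₂⟩ Finset.subset_union_left
    · rw [Finset.mem_union, Finset.mem_union, hcl i j hij]
      by_cases hj : j ∈ S
      · simp [hj]
      · have hi : i ∉ S := fun h0 => hj ((hcl i j hij).1 h0)
        have hpi : p i = j := by simp [p, hij]
        have hrel := Relation.EqvGen.rel (r := fun a b => a ∉ S ∧ p a = b) i j ⟨hi, hpi⟩
        rw [hCmem, hCmem]
        exact or_congr_right ⟨fun h => .trans _ _ _ h hrel, fun h => .trans _ _ _ h (.symm _ _ hrel)⟩
    · by_contra h0
      rcases hA₂ i j h0 with h1 | h1 | h1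
      · exact h1 (hA' i j hij)
      · have h2 := hπ.2 i
        rw [(hp i (hCS i h1.1)).1, h1.2, mem_bipEdges_inl, hij] at h2
        exact Bool.false_ne_true h2
      · rw [← h1.1, h1.2, mem_bipEdges_inl, hij] at hrs
        exact Bool.false_ne_true hrs
    · by_contra h0
      rcases hB₂ i u h0 with h1 | h1
      · exact h1 (hB' i u hiu)
      · rw [← h1.1, h1.2, mem_bipEdges_inr, hiu] at hrs
        exact Bool.false_ne_true hrs
  exact hr (hle (Finset.mem_union_right _ hrC))

/-! ### The integer linear programs -/

/-- The input links used by the matching `π`. -/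
def matchedLinks {n m : ℕ} (π : Fin n → Fin n ⊕ Fin m) : Finset (Fin n × Fin m) :=
  Finset.univ.filter fun e => π e.1 = Sum.inr e.2

theorem mem_matchedLinks {n m : ℕ} {π : Fin n → Fin n ⊕ Fin m} {e : Fin n × Fin m} :
    e ∈ matchedLinks π ↔ π e.1 = Sum.inr e.2 := by
  simp [matchedLinks]

theorem mem_freeEntries {p q : ℕ} {M : StructuredMatrix p q} {e : Fin p × Fin q} :
    e ∈ freeEntries M ↔ M e.1 e.2 = true := by
  simp [freeEntries]

theorem IsMatching.matchedLinks_subset {n m : ℕ} {A : StructuredMatrix n n}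
    {B : StructuredMatrix n m} {π : Fin n → Fin n ⊕ Fin m} (hπ : IsMatching A B π) :
    matchedLinks π ⊆ freeEntries B := by
  intro e he
  have := hπ.2 e.1
  rw [mem_matchedLinks.1 he, mem_bipEdges_inr] at this
  exact mem_freeEntries.2 this

theorem IsMatching.mono {n m : ℕ} {A : StructuredMatrix n n} {B B' : StructuredMatrix n m}
    {π : Fin n → Fin n ⊕ Fin m} (hπ : IsMatching A B π)
    (h : matchedLinks π ⊆ freeEntries B') : IsMatching A B' π := by
  refine ⟨hπ.1, fun i => ?_⟩
  have h1 := hπ.2 i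
  cases hi : π i with
  | inl j => rw [hi] at h1; exact mem_bipEdges_inl.2 (mem_bipEdges_inl.1 h1)
  | inr u => exact mem_bipEdges_inr.2 (mem_freeEntries.1 (@h (i, u) (mem_matchedLinks.2 hi)))

/-- Used with `P` selecting all input edges, for the two objectives, and those entering one source
SCC, for the constraint on `z`. -/
theorem sum_inputEdges_eq {n m : ℕ} {A : StructuredMatrix n n} {B : StructuredMatrix n m}
    {π : Fin n → Fin n ⊕ Fin m} (hπ : IsMatching A B π) {R : Type*} [Semiring R]
    (P : (Fin n ⊕ Fin m) × Fin n → Prop) [DecidablePred P] (hP : ∀ e, P e → IsInputEdge e)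
    (f : (Fin n ⊕ Fin m) × Fin n → R) :
    (∑ e : ↥(bipEdges A B) with P e.1, f e.1 * if e.1.1 = π e.1.2 then 1 else 0) =
      ∑ e ∈ matchedLinks π with P (Sum.inr e.2, e.1), f (Sum.inr e.2, e.1) := by
  simp only [mul_ite, mul_one, mul_zero]
  rw [← Finset.sum_filter, Finset.filter_filter]
  symm
  refine Finset.sum_bij (fun e he => ⟨(Sum.inr e.2, e.1), ?_⟩) ?_ ?_ ?_ ?_
  · rw [← mem_matchedLinks.1 (Finset.mem_filter.1 he).1]
    exact hπ.2 e.1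
  · intro e he
    obtain ⟨h1, h2⟩ := Finset.mem_filter.1 he
    exact Finset.mem_filter.2 ⟨Finset.mem_univ _, h2, (mem_matchedLinks.1 h1).symm⟩
  · rintro ⟨i, u⟩ _ ⟨i', u'⟩ _ h
    simpa [and_comm] using h
  · rintro ⟨⟨s, i⟩, hmem⟩ he
    obtain ⟨-, h1, h2⟩ := Finset.mem_filter.1 he
    cases s with
    | inl j => exact absurd (hP _ h1) (by simp [IsInputEdge])
    | inr u => exact ⟨(i, u), Finset.mem_filter.2 ⟨mem_matchedLinks.2 h2.symm, h1⟩, rfl⟩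
  · intro _ _; rfl

section ILP

variable {n m : ℕ} {A : StructuredMatrix n n} {B : StructuredMatrix n m}

theorem ILPVars.Admissible.y_nonneg {v : ILPVars A B} (hv : v.Admissible) (e) : 0 ≤ v.y e := by
  rcases hv.y_binary e with h | h <;> simp [h]

/-- The edges selected by an admissible point form a matching. -/
theorem ILPVars.Admissible.exists_isMatching {v : ILPVars A B} (hv : v.Admissible) :
    ∃ π, IsMatching A B π ∧ ∀ e, v.y e = if e.1.1 = π e.1.2 then 1 else 0 := by
  have hex : ∀ x : Fin n, ∃ s, ∃ h : (s, x) ∈ bipEdges A B, v.y ⟨(s, x), h⟩ = 1 ∧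
      ∀ e : ↥(bipEdges A B), e.1.2 = x → e.1.1 ≠ s → v.y e = 0 := by
    intro x
    have hsum := hv.left_eq_one x
    obtain ⟨⟨⟨s, x'⟩, hmem⟩, he, hne⟩ := Finset.exists_ne_zero_of_sum_ne_zero
      (hsum.trans_ne one_ne_zero)
    obtain rfl : x' = x := (Finset.mem_filter.1 he).2
    have h1 := (hv.y_binary _).resolve_left hne
    refine ⟨s, hmem, h1, fun e hex hes => ?_⟩
    rw [← Finset.add_sum_erase _ _ he, h1, add_eq_left,
      Finset.sum_eq_zero_iff_of_nonneg fun e _ => hv.y_nonneg e] at hsum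
    exact hsum e (Finset.mem_erase.2 ⟨fun h0 => hes (by rw [h0]),
      Finset.mem_filter.2 ⟨Finset.mem_univ _, hex⟩⟩)
  choose π hmem h1 h0 using hex
  refine ⟨π, ⟨fun x x' hxx => ?_, hmem⟩, fun e => ?_⟩
  · by_contra hne
    have hle := hv.right_le_one (π x)
    have hpair : ∑ e ∈ ({⟨(π x, x), hmem x⟩, ⟨(π x', x'), hmem x'⟩} : Finset ↥(bipEdges A B)), v.y e
        = 2 := by
      rw [Finset.sum_pair (fun h => hne (congrArg (fun e => e.1.2) h)), h1, h1]; rfl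
    have := Finset.sum_le_sum_of_subset_of_nonneg (f := v.y)
      (s := {⟨(π x, x), hmem x⟩, ⟨(π x', x'), hmem x'⟩})
      (t := Finset.univ.filter fun e : ↥(bipEdges A B) => e.1.1 = π x)
      (by
        intro e he
        rw [Finset.mem_insert, Finset.mem_singleton] at he
        refine Finset.mem_filter.2 ⟨Finset.mem_univ _, ?_⟩
        rcases he with rfl | rfl
        · rfl
        · exact hxx.symm) (fun e _ _ => hv.y_nonneg e)
    omega
  · obtain ⟨⟨s, x⟩, he⟩ := e
    by_cases hs : s = π x
    · subst hs
      rw [if_pos rfl, h1]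
    · rw [if_neg hs, h0 x _ rfl hs]

theorem ILPVars.linkCount_eq {v : ILPVars A B} (hz : ∀ S, v.z S = 0 ∨ v.z S = 1)
    {π : Fin n → Fin n ⊕ Fin m} (hπ : IsMatching A B π)
    (hy : ∀ e, v.y e = if e.1.1 = π e.1.2 then 1 else 0) :
    v.linkCount = (matchedLinks π).card + (Finset.univ.filter fun S => v.z S = 0).card := by
  have h1 := sum_inputEdges_eq hπ IsInputEdge (fun _ h => h) (fun _ => (1 : ℤ))
  have h2 : ∑ S, (1 - v.z S) = (Finset.univ.filter fun S => v.z S = 0).card := by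
    rw [Finset.card_filter, Nat.cast_sum]
    refine Finset.sum_congr rfl fun S _ => ?_
    rcases hz S with h | h <;> simp [h]
  rw [Finset.sum_sub_distrib] at h2
  simp only [one_mul, ← hy, IsInputEdge, Sum.isRight_inr, Finset.filter_true] at h1
  simp only [Finset.sum_const, nsmul_eq_mul, mul_one, Finset.card_univ, Fintype.card_coe] at h1 h2
  rw [ILPVars.linkCount, ← h2, ← h1]
  simp only [IsInputEdge]
  ring

theorem ILPVars.linkCost_eq {v : ILPVars A B} (hz : ∀ S, v.z S = 0 ∨ v.z S = 1)
    {π : Fin n → Fin n ⊕ Fin m} (hπ : IsMatching A B π)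
    (hy : ∀ e, v.y e = if e.1.1 = π e.1.2 then 1 else 0) (w : Fin n → Fin m → ℝ) :
    v.linkCost w = ∑ e ∈ matchedLinks π, w e.1 e.2 +
      ∑ S with v.z S = 0, minLinkCost B w S.1 := by
  have h1 := sum_inputEdges_eq hπ IsInputEdge (fun _ h => h) (edgeCost w)
  simp only [IsInputEdge, Sum.isRight_inr, Finset.filter_true, edgeCost, Sum.elim_inr] at h1
  rw [ILPVars.linkCost, ← h1, Finset.sum_filter (fun S => v.z S = 0)]
  congr 1
  · refine Finset.sum_congr rfl fun e _ => ?_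
    rw [hy]; simp [edgeCost]
  · refine Finset.sum_congr rfl fun S _ => ?_
    rcases hz S with h | h <;> simp [h]

theorem isSourceSCC_of_mem (S : ↥(sourceSCCs A)) : IsSourceSCC A S.1 := by
  classical
  exact (Finset.mem_filter.1 S.2).2

theorem finite_linkCosts (B : StructuredMatrix n m) (w : Fin n → Fin m → ℝ) (S : Finset (Fin n)) :
    {c | ∃ i j, i ∈ S ∧ B i j = true ∧ c = w i j}.Finite :=
  (Set.finite_range fun e : Fin n × Fin m => w e.1 e.2).subset
    fun _ ⟨i, j, _, _, h⟩ => ⟨(i, j), h.symm⟩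

theorem minLinkCost_le (w : Fin n → Fin m → ℝ) {S : Finset (Fin n)} {i : Fin n} {j : Fin m}
    (hi : i ∈ S) (hij : B i j = true) : minLinkCost B w S ≤ w i j :=
  csInf_le (finite_linkCosts B w S).bddBelow ⟨i, j, hi, hij, rfl⟩

theorem exists_eq_minLinkCost (w : Fin n → Fin m → ℝ) {S : Finset (Fin n)}
    (h : ∃ i ∈ S, ∃ j, B i j = true) :
    ∃ e : Fin n × Fin m, e.1 ∈ S ∧ B e.1 e.2 = true ∧ w e.1 e.2 = minLinkCost B w S := by
  obtain ⟨i, hi, j, hij⟩ := h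
  have hne : {c | ∃ i j, i ∈ S ∧ B i j = true ∧ c = w i j}.Nonempty := ⟨_, i, j, hi, hij, rfl⟩
  obtain ⟨i, j, hi, hij, hc⟩ := hne.csInf_mem (finite_linkCosts B w S)
  exact ⟨(i, j), hi, hij, hc.symm⟩

/-- Distinct source SCCs are disjoint, so a link serves at most one of them. -/
theorem injective_of_mem_source {c : ↥(sourceSCCs A) → Fin n × Fin m}
    (hc : ∀ S, (c S).1 ∈ S.1) : Function.Injective c := fun S S' h =>
  Subtype.ext ((isSourceSCC_of_mem S).eq_of_mem (isSourceSCC_of_mem S') (hc S) (h ▸ hc S'))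

/-! ### Translations between selections and admissible points -/

/-- Every admissible point of the programs yields a selection that is at most as expensive. -/
theorem ILPVars.Admissible.exists_selection {w : Fin n → Fin m → ℝ}
    (hAB : StructurallyControllable A B) (hw : ∀ i j, B i j = true → 0 ≤ w i j)
    {v : ILPVars A B} (hv : v.Admissible) :
    ∃ B' ∈ selectionFeasible A B, sparsity B' ≤ v.linkCount ∧ totalCost w B' ≤ v.linkCost w := by
  classical
  obtain ⟨π, hπ, hy⟩ := hv.exists_isMatching
  choose c hcS hcB hcw using fun S : ↥(sourceSCCs A) =>
    exists_eq_minLinkCost w (hAB.exists_link (isSourceSCC_of_mem S))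
  let Z : Finset ↥(sourceSCCs A) := Finset.univ.filter fun S => v.z S = 0
  -- The union need not be disjoint: `z S = 0` is allowed even when the matching links `S`. Hence
  -- only inequalities result, and for the cost the overlap must be non-negative.
  let F : Finset (Fin n × Fin m) := matchedLinks π ∪ Z.image c
  let B' : StructuredMatrix n m := fun i j => decide ((i, j) ∈ F)
  have hF : freeEntries B' = F := by
    ext e; exact mem_freeEntries.trans decide_eq_true_iff
  have hFB : F ⊆ freeEntries B := Finset.union_subset hπ.matchedLinks_subset
    (Finset.image_subset_iff.2 fun S _ => mem_freeEntries.2 (hcB S))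
  refine ⟨B', ⟨?_, ?_⟩, ?_, ?_⟩
  · exact hF.trans_subset hFB
  · refine structurallyControllable_of_isMatching (fun S hS => ?_)
      (hπ.mono (hF ▸ Finset.subset_union_left))
    have hmem : S ∈ sourceSCCs A := Finset.mem_filter.2 ⟨Finset.mem_univ _, hS⟩
    suffices h : ∃ e ∈ F, e.1 ∈ S by
      obtain ⟨e, he, heS⟩ := h
      exact ⟨e.1, heS, e.2, mem_freeEntries.1 (hF ▸ he)⟩
    rcases hv.z_binary ⟨S, hmem⟩ with h0 | h1
    · exact ⟨c ⟨S, hmem⟩, Finset.mem_union_right _ (Finset.mem_image_of_mem c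
        (Finset.mem_filter.2 ⟨Finset.mem_univ _, h0⟩)), hcS _⟩
    · have h2 := hv.z_le ⟨S, hmem⟩
      have h3 := sum_inputEdges_eq hπ (fun e => IsInputEdge e ∧ e.2 ∈ S) (fun _ h => h.1)
        (fun _ => (1 : ℤ))
      simp only [one_mul, ← hy] at h3
      rw [h1, h3] at h2
      obtain ⟨e, he, -⟩ := Finset.exists_ne_zero_of_sum_ne_zero (zero_lt_one.trans_le h2).ne'
      obtain ⟨he1, he2⟩ := Finset.mem_filter.1 he
      exact ⟨e, Finset.mem_union_left _ he1, he2.2⟩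
  · rw [sparsity, hF, ILPVars.linkCount_eq hv.z_binary hπ hy]
    exact_mod_cast (Finset.card_union_le _ _).trans
      (Nat.add_le_add_left Finset.card_image_le _)
  · rw [totalCost, hF, ILPVars.linkCost_eq hv.z_binary hπ hy]
    have h1 := Finset.sum_union_inter (s₁ := matchedLinks π) (s₂ := Z.image c)
      (f := fun e => w e.1 e.2)
    rw [Finset.sum_image (injective_of_mem_source hcS).injOn] at h1
    simp only [hcw] at h1
    have h2 : 0 ≤ ∑ e ∈ matchedLinks π ∩ Z.image c, w e.1 e.2 := Finset.sum_nonneg fun e he =>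
      hw _ _ (mem_freeEntries.1 (hπ.matchedLinks_subset (Finset.mem_inter.1 he).1))
    linarith

/-- Every selection yields an admissible point of the programs that is at most as expensive. -/
theorem exists_admissible_of_selection {w : Fin n → Fin m → ℝ}
    (hw : ∀ i j, B i j = true → 0 ≤ w i j) {B' : StructuredMatrix n m}
    (hB' : B' ∈ selectionFeasible A B) :
    ∃ v : ILPVars A B, v.Admissible ∧ v.linkCount ≤ sparsity B' ∧
      v.linkCost w ≤ totalCost w B' := by
  classical
  obtain ⟨hsub, hctrl⟩ := hB'
  obtain ⟨π, hπ'⟩ := hctrl.exists_isMatching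
  have hπ : IsMatching A B π := hπ'.mono (hπ'.matchedLinks_subset.trans hsub)
  choose r hrS u hru using fun S : ↥(sourceSCCs A) => hctrl.exists_link (isSourceSCC_of_mem S)
  let c : ↥(sourceSCCs A) → Fin n × Fin m := fun S => (r S, u S)
  -- Each `z S` is as large as its constraint permits. Hence a link of `B'` into an `S` with `z S =
  -- 0` is never a matched one, and the union below is disjoint.
  let v : ILPVars A B :=
    { y := fun e => if e.1.1 = π e.1.2 then 1 else 0
      z := fun S => if ∃ e ∈ matchedLinks π, e.1 ∈ S.1 then 1 else 0 }
  have hz : ∀ S, v.z S = 0 ∨ v.z S = 1 := fun S => (ite_eq_or_eq _ _ _).symm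
  have hv : v.Admissible := by
    refine ⟨fun x => ?_, fun s => ?_, fun S => ?_, fun e => (ite_eq_or_eq _ _ _).symm, hz⟩
    · rw [Finset.sum_eq_single ⟨(π x, x), hπ.2 x⟩]
      · exact if_pos rfl
      · rintro ⟨⟨s, x'⟩, hmem⟩ he hne
        obtain rfl : x' = x := (Finset.mem_filter.1 he).2
        refine if_neg fun h => hne (Subtype.ext ?_)
        exact Prod.ext h rfl
      · intro h
        exact absurd (by rw [Finset.mem_filter]; exact ⟨Finset.mem_univ _, rfl⟩) h
    · simp only [v]
      rw [Finset.sum_boole, Nat.cast_le_one, Finset.card_le_one]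
      rintro ⟨⟨s₁, x₁⟩, h₁⟩ he₁ ⟨⟨s₂, x₂⟩, h₂⟩ he₂
      simp only [Finset.mem_filter, Finset.mem_univ, true_and] at he₁ he₂
      obtain rfl : x₁ = x₂ := hπ.1 (by rw [← he₁.2, ← he₂.2, he₁.1, he₂.1])
      simp [he₁.1, he₂.1]
    · have h3 := sum_inputEdges_eq hπ (fun e => IsInputEdge e ∧ e.2 ∈ S.1) (fun _ h => h.1)
        (fun _ => (1 : ℤ))
      simp only [one_mul] at h3
      refine le_of_le_of_eq ?_ h3.symm
      rcases hz S with h | h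
      · rw [h]
        exact Finset.sum_nonneg fun _ _ => zero_le_one
      · obtain ⟨e, he, heS⟩ : ∃ e ∈ matchedLinks π, e.1 ∈ S.1 := by
          by_contra hno
          exact zero_ne_one ((if_neg hno : v.z S = 0).symm.trans h)
        rw [h]
        exact Finset.single_le_sum (f := fun _ => (1 : ℤ)) (fun _ _ => zero_le_one)
          (Finset.mem_filter.2 ⟨he, rfl, heS⟩)
  let Z : Finset ↥(sourceSCCs A) := Finset.univ.filter fun S => v.z S = 0
  have hdisj : Disjoint (matchedLinks π) (Z.image c) := by
    rw [Finset.disjoint_right]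
    intro e he hmem
    obtain ⟨S, hS, rfl⟩ := Finset.mem_image.1 he
    have h1 : v.z S = 1 := if_pos ⟨_, hmem, hrS S⟩
    exact zero_ne_one ((Finset.mem_filter.1 hS).2.symm.trans h1)
  have hle : matchedLinks π ∪ Z.image c ⊆ freeEntries B' :=
    Finset.union_subset hπ'.matchedLinks_subset
      (Finset.image_subset_iff.2 fun S _ => mem_freeEntries.2 (hru S))
  have hinj : Function.Injective c := injective_of_mem_source hrS
  refine ⟨v, hv, ?_, ?_⟩
  · rw [ILPVars.linkCount_eq hz hπ fun _ => rfl, sparsity]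
    have := Finset.card_le_card hle
    rw [Finset.card_union_of_disjoint hdisj, Finset.card_image_of_injective _ hinj] at this
    exact_mod_cast this
  · rw [ILPVars.linkCost_eq hz hπ fun _ => rfl, totalCost]
    refine le_trans ?_ (Finset.sum_le_sum_of_subset_of_nonneg hle
      fun e he _ => hw _ _ (mem_freeEntries.1 (hsub he)))
    rw [Finset.sum_union hdisj, Finset.sum_image hinj.injOn]
    refine add_le_add_right (Finset.sum_le_sum fun S hS =>
      minLinkCost_le w (hrS S) (mem_freeEntries.1 (hsub (@hle (c S) ?_)))) _
    exact Finset.mem_union_right _ (Finset.mem_image_of_mem c hS)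

end ILP

/-- Finiteness is needed only for `Λ`, the selections: the point of `Λ'` below a minimizer in `Λ` is
itself a minimizer. -/
theorem exists_isOptimalValue {α β γ : Type*} [LinearOrder γ] {Λ : Set α} {Λ' : Set β}
    {f : α → γ} {g : β → γ} (hfin : Λ.Finite) (hne : Λ.Nonempty)
    (h₁ : ∀ x ∈ Λ, ∃ y ∈ Λ', g y ≤ f x) (h₂ : ∀ y ∈ Λ', ∃ x ∈ Λ, f x ≤ g y) :
    ∃ v, IsOptimalValue Λ f v ∧ IsOptimalValue Λ' g v := by
  obtain ⟨x, hx, hmin⟩ := Set.exists_min_image Λ f hfin hne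
  obtain ⟨y, hy, hyx⟩ := h₁ x hx
  have hle : ∀ y' ∈ Λ', f x ≤ g y' := fun y' hy' => by
    obtain ⟨x', hx', h⟩ := h₂ y' hy'
    exact (hmin x' hx').trans h
  refine ⟨f x, ⟨⟨x, hx, rfl⟩, ?_⟩, ⟨⟨y, hy, hyx.antisymm (hle y hy)⟩, ?_⟩⟩
  · rintro _ ⟨x', hx', rfl⟩
    exact hmin x' hx'
  · rintro _ ⟨y', hy', rfl⟩
    exact hle y' hy'

end InputSelection

theorem mainTheorem6 {n m : ℕ} (A : StructuredMatrix n n) (B : StructuredMatrix n m)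
    (w : Fin n → Fin m → ℝ)
    (hAB : StructurallyControllable A B)
    (hw : ∀ i j, B i j = true → 0 ≤ w i j) :
    (∃ v : ℤ, IsOptimalValue (selectionFeasible A B) sparsity v ∧
      IsOptimalValue (ilpFeasible A B) ILPVars.linkCount v) ∧
    (∃ v : ℝ, IsOptimalValue (selectionFeasible A B) (totalCost w) v ∧
      IsOptimalValue (ilpFeasible A B) (ILPVars.linkCost w) v) ∧
    (∀ k : ℕ,
      ((sparseSelectionFeasible A B k).Nonempty ↔ (sparseIlpFeasible A B k).Nonempty) ∧
      ((sparseSelectionFeasible A B k).Nonempty →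
        ∃ v : ℝ, IsOptimalValue (sparseSelectionFeasible A B k) (totalCost w) v ∧
          IsOptimalValue (sparseIlpFeasible A B k) (ILPVars.linkCost w) v)) := by
  have hsel : ∀ B' ∈ selectionFeasible A B, ∃ v ∈ ilpFeasible A B,
      v.linkCount ≤ sparsity B' ∧ v.linkCost w ≤ totalCost w B' :=
    fun B' hB' => exists_admissible_of_selection hw hB'
  have hilp : ∀ v ∈ ilpFeasible A B, ∃ B' ∈ selectionFeasible A B,
      sparsity B' ≤ v.linkCount ∧ totalCost w B' ≤ v.linkCost w :=
    fun v hv => ILPVars.Admissible.exists_selection hAB hw hv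
  have hne : (selectionFeasible A B).Nonempty := ⟨B, Finset.Subset.refl _, hAB⟩
  refine ⟨exists_isOptimalValue (Set.toFinite _) hne
      (fun B' hB' => (hsel B' hB').imp fun _ h => ⟨h.1, h.2.1⟩)
      (fun v hv => (hilp v hv).imp fun _ h => ⟨h.1, h.2.1⟩),
    exists_isOptimalValue (Set.toFinite _) hne
      (fun B' hB' => (hsel B' hB').imp fun _ h => ⟨h.1, h.2.2⟩)
      (fun v hv => (hilp v hv).imp fun _ h => ⟨h.1, h.2.2⟩), fun k => ?_⟩
  -- The same translation controls count and cost simultaneously, so the bound `k` is inherited.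
  have hsel' : ∀ B' ∈ sparseSelectionFeasible A B k, ∃ v ∈ sparseIlpFeasible A B k,
      v.linkCost w ≤ totalCost w B' := fun B' hB' =>
    (hsel B' hB'.1).imp fun _ h => ⟨⟨h.1, h.2.1.trans hB'.2⟩, h.2.2⟩
  have hilp' : ∀ v ∈ sparseIlpFeasible A B k, ∃ B' ∈ sparseSelectionFeasible A B k,
      totalCost w B' ≤ v.linkCost w := fun v hv =>
    (hilp v hv.1).imp fun _ h => ⟨⟨h.1, h.2.1.trans hv.2⟩, h.2.2⟩
  refine ⟨⟨fun ⟨B', hB'⟩ => ?_, fun ⟨v, hv⟩ => ?_⟩,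
    fun h => exists_isOptimalValue (Set.toFinite _) h hsel' hilp'⟩
  · obtain ⟨v, hv, -⟩ := hsel' B' hB'
    exact ⟨v, hv⟩
  · obtain ⟨B', hB', -⟩ := hilp' v hv
    exact ⟨B', hB'⟩
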